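/- Let $a_1a_2a_3\cdots = 31232\,1\,2\,31232\,2\,1\,2\,31232\,1\,2\,31232\,2\,2\cdots$ be the fixed point, starting with the letter $3$, of the morphism $\sigma_2:\ 3\mapsto 31232,\ 2\mapsto 2,\ 1\mapsto 1$ on words over $\{1,2,3\}$ (there is exactly one such infinite word). For a real number $\beta>1$ let $$T_{-\beta}:\ \Big[\tfrac{-\beta}{\beta+1},\tfrac{1}{\beta+1}\Big)\to\Big[\tfrac{-\beta}{\beta+1},\tfrac{1}{\beta+1}\Big),\qquad x\mapsto -\beta x-\Big\lfloor \tfrac{\beta}{\beta+1}-\beta x\Big\rfloor ,$$ and let $\mathbb{Z}_{-\beta}=\bigcup_{n\ge 0}(-\beta)^n\,T_{-\beta}^{-n}(0)$ be the set of $(-\beta)$-integers. Then there is a real number $\beta>1$ such that: 1. $a_1a_2\cdots$ is the $(-\beta)$-expansion of $\frac{-\beta}{\beta+1}$; that is, with $t_n=T_{-\beta}^n\big(\frac{-\beta}{\beta+1}\big)$ for $n\ge 0$, we have $a_n=\big\lfloor \frac{\beta}{\beta+1}-\beta t_{n-1}\big\rfloor$ for all $n\ge 1$, and $t_n=\sum_{k=1}^\infty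 \frac{a_{n+k}}{(-\beta)^k}$ for all $n\ge 0$; 2. $\mathbb{Z}_{-\beta}$ is not relatively dense in $\mathbb{R}$, i.e. there is no $R>0$ such that every interval of length $R$ contains a point of $\mathbb{Z}_{-\beta}$; moreover, the distances between consecutive elements of $\mathbb{Z}_{-\beta}$ are unbounded: for every $C$ there are $x<y$ in $\mathbb{Z}_{-\beta}$ with $(x,y)\cap\mathbb{Z}_{-\beta}=\emptyset$ and $y-x>C$. -/

import Mathlib

/-! ### Infinite words, morphisms and their fixed points -/

/-- The three-letter alphabet `{1, 2, 3}`. -/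
inductive Letter where
  | one
  | two
  | three

/-- The letter read as an integer digit. -/
def Letter.digit : Letter → ℤ
  | .one => 1
  | .two => 2
  | .three => 3

/-- The prefix of length `n` of an infinite word. -/
def wordPrefix {A : Type*} (w : ℕ → A) (n : ℕ) : List A := (List.range n).map w

/-- A morphism of the free monoid over `A` is given by the images `σ : A → List A` of the letters
(a finite word `l` is mapped to `l.flatMap σ`). The infinite word `v` is the image of the infinite
word `w`: the images of the prefixes of `w` are prefixes of `v`, of unbounded lengths. -/
def IsImageWord {A : Type*} (σ : A → List A) (w v : ℕ → A) : Prop :=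
  (∀ n, ∃ m, (wordPrefix w n).flatMap σ = wordPrefix v m) ∧
    ∀ N, ∃ n, N ≤ ((wordPrefix w n).flatMap σ).length

/-- The infinite word `w` is a fixed point of the morphism `σ`. -/
def IsFixedPointOfMorphism {A : Type*} (σ : A → List A) (w : ℕ → A) : Prop :=
  IsImageWord σ w w

/-- The morphism `3 ↦ 31232, 2 ↦ 2, 1 ↦ 1`. -/
def sigma₂ : Letter → List Letter
  | .one => [.one]
  | .two => [.two]
  | .three => [.three, .one, .two, .three, .two]

theorem wordPrefix_length {A : Type*} (w : ℕ → A) (n : ℕ) : (wordPrefix w n).length = n := by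
  simp [wordPrefix]

theorem sigma₂_length_le (l : List Letter) : l.length ≤ (l.flatMap sigma₂).length := by
  induction l with
  | nil => simp
  | cons c l ih => cases c <;> simp [sigma₂] at * <;> omega

/-- The words `σ₂ᵏ(3)`. -/
def sigma₂Iter : ℕ → List Letter
  | 0 => [.three]
  | k + 1 => (sigma₂Iter k).flatMap sigma₂

theorem sigma₂Iter_prefix_succ (k : ℕ) : sigma₂Iter k <+: sigma₂Iter (k + 1) := by
  induction k with
  | zero => simp [sigma₂Iter, sigma₂]
  | succ k ih => exact ih.flatMap sigma₂

theorem sigma₂Iter_prefix {j k : ℕ} (h : j ≤ k) : sigma₂Iter j <+: sigma₂Iter k := by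
  induction h with
  | refl => exact List.prefix_rfl
  | step _ ih => exact ih.trans (sigma₂Iter_prefix_succ _)

theorem sigma₂Iter_cons (k : ℕ) : ∃ l, sigma₂Iter k = Letter.three :: l := by
  obtain ⟨l, hl⟩ := sigma₂Iter_prefix (Nat.zero_le k)
  exact ⟨l, by simpa [sigma₂Iter] using hl.symm⟩

theorem lt_sigma₂Iter_length (k : ℕ) : k < (sigma₂Iter k).length := by
  induction k with
  | zero => simp [sigma₂Iter]
  | succ k ih =>
    obtain ⟨l, hl⟩ := sigma₂Iter_cons k
    have h := sigma₂_length_le l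
    rw [hl, List.length_cons] at ih
    simp only [sigma₂Iter, hl, List.flatMap_cons, sigma₂, List.length_append, List.length_cons,
      List.length_nil]
    omega

/-- There is exactly one fixed point of `3 ↦ 31232, 2 ↦ 2, 1 ↦ 1` that starts with the
letter `3`. -/
theorem existsUnique_fixedPoint_sigma₂ :
    ∃! a : ℕ → Letter, IsFixedPointOfMorphism sigma₂ a ∧ a 0 = Letter.three := by
  have key : ∀ {v : ℕ → Letter}, IsFixedPointOfMorphism sigma₂ v → v 0 = Letter.three →
      ∀ k, sigma₂Iter k = wordPrefix v (sigma₂Iter k).length := by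
    intro v hv h0 k
    induction k with
    | zero => simp [sigma₂Iter, wordPrefix, h0]
    | succ k ih =>
      obtain ⟨m, hm⟩ := hv.1 (sigma₂Iter k).length
      rw [← ih] at hm
      have hlen : (sigma₂Iter (k + 1)).length = m := by
        rw [show sigma₂Iter (k + 1) = (sigma₂Iter k).flatMap sigma₂ from rfl, hm,
          wordPrefix_length]
      rw [hlen]
      exact hm
  let w : ℕ → Letter := fun n => (sigma₂Iter n).getD n Letter.one
  have hw : ∀ l : List Letter, ∀ k, l <+: sigma₂Iter k → l = wordPrefix w l.length := by
    intro l k hl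
    apply List.ext_getElem
    · rw [wordPrefix_length]
    · intro i h1 h2
      have h3 := lt_sigma₂Iter_length i
      have e1 := (hl.trans (sigma₂Iter_prefix (le_max_left k i))).getElem h1
      have e2 := (sigma₂Iter_prefix (le_max_right k i)).getElem h3
      rw [e1]
      simp [wordPrefix, w, List.getElem?_eq_getElem h3, e2]
  have hpre : ∀ n, wordPrefix w n <+: sigma₂Iter n := by
    intro n
    have h1 : (sigma₂Iter n).take n <+: sigma₂Iter n := List.take_prefix _ _
    have h2 := hw _ n h1
    have h3 := lt_sigma₂Iter_length n
    rw [List.length_take, min_eq_left h3.le] at h2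
    rw [← h2]
    exact h1
  refine ⟨w, ⟨⟨fun n => ⟨_, hw _ (n + 1) ((hpre n).flatMap sigma₂)⟩, fun N => ⟨N, ?_⟩⟩, ?_⟩, ?_⟩
  · have := sigma₂_length_le (wordPrefix w N)
    rwa [wordPrefix_length] at this
  · simp [w, sigma₂Iter]
  · rintro v ⟨hv, h0⟩
    funext n
    have h3 := lt_sigma₂Iter_length n
    have e1 := key hv h0 n
    have e2 : (sigma₂Iter n)[n] = v n := by
      have : (sigma₂Iter n)[n]? = (wordPrefix v (sigma₂Iter n).length)[n]? := by rw [← e1]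
      rw [List.getElem?_eq_getElem h3] at this
      simpa [wordPrefix, h3] using this
    simp [w, List.getElem?_eq_getElem h3, e2]

/-! ### The `(-β)`-transformation, `(-β)`-expansions and `(-β)`-integers -/

/-- The `(-β)`-transformation `x ↦ -βx - ⌊β/(β+1) - βx⌋`. The formula is used on all of `ℝ`;
see `negBetaMap_mem` for the invariance of the interval `[-β/(β+1), 1/(β+1))`. -/
noncomputable def negBetaMap (β x : ℝ) : ℝ := -β * x - (⌊β / (β + 1) - β * x⌋ : ℤ)

theorem negBetaMap_mem {β : ℝ} (hβ : 1 < β) (x : ℝ) :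
    negBetaMap β x ∈ Set.Ico (-β / (β + 1)) (1 / (β + 1)) := by
  have h1 := Int.floor_le (β / (β + 1) - β * x)
  have h2 := Int.lt_floor_add_one (β / (β + 1) - β * x)
  have h3 : 1 / (β + 1) = 1 - β / (β + 1) := by field_simp; ring
  have h4 : -β / (β + 1) = -(β / (β + 1)) := neg_div _ _
  rw [Set.mem_Ico, h3, h4]
  unfold negBetaMap
  constructor <;> linarith

/-- The sequence `d 0, d 1, d 2, …` is the `(-β)`-expansion of `x ∈ [-β/(β+1), 1/(β+1))`: its terms
are the digits `⌊β/(β+1) - β Tⁿ(x)⌋` produced by the `(-β)`-transformation `T`, and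
`Tⁿ(x) = ∑_{k ≥ 1} d (n+k-1) / (-β)^k` for all `n`. -/
structure IsNegBetaExpansion (β x : ℝ) (d : ℕ → ℤ) : Prop where
  mem : x ∈ Set.Ico (-β / (β + 1)) (1 / (β + 1))
  digit_eq : ∀ n, d n = ⌊β / (β + 1) - β * (negBetaMap β)^[n] x⌋
  hasSum : ∀ n, HasSum (fun k : ℕ => (d (n + k) : ℝ) / (-β) ^ (k + 1)) ((negBetaMap β)^[n] x)

/-- The set of `(-β)`-integers `⋃_{n ≥ 0} (-β)ⁿ T⁻ⁿ(0)`, where `T` is the `(-β)`-transformation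
on `[-β/(β+1), 1/(β+1))`. -/
def negBetaIntegers (β : ℝ) : Set ℝ :=
  ⋃ n : ℕ, (fun x => (-β) ^ n * x) ''
    {x | x ∈ Set.Ico (-β / (β + 1)) (1 / (β + 1)) ∧ (negBetaMap β)^[n] x = 0}

/-- `S ⊆ ℝ` is relatively dense: for some `R > 0`, every interval of length `R` contains a point
of `S`. -/
def IsRelativelyDense (S : Set ℝ) : Prop :=
  ∃ R : ℝ, 0 < R ∧ ∀ x : ℝ, (S ∩ Set.Icc x (x + R)).Nonempty

/-- `x < y` are consecutive elements of `S`. -/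
def IsConsecutive (S : Set ℝ) (x y : ℝ) : Prop :=
  x ∈ S ∧ y ∈ S ∧ x < y ∧ S ∩ Set.Ioo x y = ∅

/-!
The fixed point `a = 31232⋯` is strictly smaller than all its proper shifts in the alternate
lexicographic order (`altLT_of_pos`): `σ₂` respects this order because the images of all letters
have odd length. The intermediate value theorem gives some `β` strictly between `3` and `4` for
which the value of `a` in base `-β` is `-β / (β + 1)` (`exists_tailValue_zero_eq`). As `β > 3` and
the digits differ by at most `2`, the values `t n` of the shifts are ordered like the shifts, so
they all lie in the domain of the `(-β)`-transformation `T`. Hence `t` is the `T`-orbit of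
`t 0 = -β / (β + 1)`, the digits are those of `a`, and all `t n` are negative
(`exists_isCriticalOrbit`).

The restriction of `T ^ q` to a short interval to the right of `t 0`, enlarged by the factor
`β ^ q`, describes the `(-β)`-integers to the right of `(-β) ^ q * t 0` when `q` is even: after
division by `β ^ q`, they are the zeros of `T ^ q` (`IsCriticalOrbit.iterate_eq_zero`). Therefore
it suffices to find even `q` such that `T ^ q` is negative on an interval
`[t 0, t 0 + L / β ^ q]` with `L` large. This is done for `q + 1` equal to the length of `σ₂ᵏ(3)`,
with `L = k / 4`, by induction on `k` (`IsCriticalOrbit.isNegativeAt_step`). The prefix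
`u = σ₂ᵏ(3)` of `a` is followed by `1 2 u 2`, so that `t (q + 3)` has a long common prefix with
`t 0`. On the way from `q` to `2 * q + 4`, the interval `[t 0, t (q + 3)]` is not cut for `q + 1`
steps and contributes one negative branch of length at least `1 / 4`; the part of the interval
beyond it wraps around the right end of the domain and returns to `t 0` with exactly `q` steps left,
so that the previous negative interval is appended.

Finally, the set of `(-β)`-integers is locally finite and unbounded in both directions, so each
interval that it misses lies between two consecutive elements.
-/

/-! ### The combinatorics of the fixed point -/

/-- The position at which the image of the `n`-th letter of `a` begins in the image of `a`. -/
def imagePos (a : ℕ → Letter) (n : ℕ) : ℕ := ((wordPrefix a n).flatMap sigma₂).length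

theorem wordPrefix_succ {A : Type*} (w : ℕ → A) (n : ℕ) :
    wordPrefix w (n + 1) = wordPrefix w n ++ [w n] := by
  simp [wordPrefix, List.range_succ]

theorem imagePos_zero (a : ℕ → Letter) : imagePos a 0 = 0 := by
  simp [imagePos, wordPrefix]

theorem imagePos_succ (a : ℕ → Letter) (n : ℕ) :
    imagePos a (n + 1) = imagePos a n + (sigma₂ (a n)).length := by
  simp [imagePos, wordPrefix_succ]

theorem flatMap_wordPrefix {a : ℕ → Letter} (ha : IsFixedPointOfMorphism sigma₂ a) (n : ℕ) :
    (wordPrefix a n).flatMap sigma₂ = wordPrefix a (imagePos a n) := by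
  obtain ⟨m, hm⟩ := ha.1 n
  rw [imagePos, hm, wordPrefix_length]

theorem apply_imagePos_add {a : ℕ → Letter} (ha : IsFixedPointOfMorphism sigma₂ a) (n : ℕ)
    {i : ℕ} (hi : i < (sigma₂ (a n)).length) :
    a (imagePos a n + i) = (sigma₂ (a n))[i] := by
  have h := flatMap_wordPrefix ha (n + 1)
  rw [wordPrefix_succ, List.flatMap_append, flatMap_wordPrefix ha n] at h
  have h' := congrArg (fun l => l[imagePos a n + i]?) h
  simp only [List.flatMap_cons, List.flatMap_nil, List.append_nil] at h'
  rw [List.getElem?_append_right (by simp [wordPrefix_length]), wordPrefix_length,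
    Nat.add_sub_cancel_left, List.getElem?_eq_getElem hi] at h'
  have hlt : imagePos a n + i < imagePos a (n + 1) := by rw [imagePos_succ]; omega
  simpa [wordPrefix, hlt] using h'.symm

theorem sigma₂_getElem_zero (c : Letter) (h : 0 < (sigma₂ c).length) : (sigma₂ c)[0] = c := by
  cases c <;> rfl

theorem eq_three_of_sigma₂_getElem {c : Letter} {i : ℕ} (hi : i < (sigma₂ c).length)
    (h : (sigma₂ c)[i] = .three) : c = .three ∧ (i = 0 ∨ i = 3) := by
  cases c <;> simp only [sigma₂, List.length_cons, List.length_nil] at hi <;> interval_cases i <;>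
    simp_all [sigma₂]

theorem apply_imagePos {a : ℕ → Letter} (ha : IsFixedPointOfMorphism sigma₂ a) (n : ℕ) :
    a (imagePos a n) = a n := by
  have h : 0 < (sigma₂ (a n)).length := by cases a n <;> simp [sigma₂]
  have := apply_imagePos_add ha n h
  rw [Nat.add_zero] at this
  rw [this, sigma₂_getElem_zero]

/-- All images `σ₂(c)` have odd length, so passing to the image preserves parity. -/
theorem imagePos_mod_two (a : ℕ → Letter) (n : ℕ) : imagePos a n % 2 = n % 2 := by
  induction n with
  | zero => simp [imagePos_zero]
  | succ n ih => rw [imagePos_succ]; cases a n <;> simp [sigma₂] <;> omega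

theorem lt_imagePos {a : ℕ → Letter} (ha0 : a 0 = .three) {n : ℕ} (hn : 0 < n) :
    n < imagePos a n := by
  induction n, hn using Nat.le_induction with
  | base => simp [imagePos_succ, imagePos_zero, ha0, sigma₂]
  | succ n _ ih => rw [imagePos_succ]; cases a n <;> simp [sigma₂] <;> omega

theorem exists_imagePos_add_eq (a : ℕ → Letter) (n : ℕ) :
    ∃ m i, i < (sigma₂ (a m)).length ∧ imagePos a m + i = n := by
  induction n with
  | zero => exact ⟨0, 0, by cases a 0 <;> simp [sigma₂], imagePos_zero a⟩
  | succ n ih =>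
    obtain ⟨m, i, hi, rfl⟩ := ih
    by_cases h : i + 1 < (sigma₂ (a m)).length
    · exact ⟨m, i + 1, h, rfl⟩
    · refine ⟨m + 1, 0, by cases a (m + 1) <;> simp [sigma₂], ?_⟩
      rw [imagePos_succ]; omega

/-- An occurrence at `n` of the prefix of length `k` of `a` is mapped by `σ₂` to an occurrence at
`imagePos a n` of the prefix of length `imagePos a k`. -/
theorem imagePos_agree {a : ℕ → Letter} (ha : IsFixedPointOfMorphism sigma₂ a) {n k : ℕ}
    (h : ∀ i < k, a (n + i) = a i) :
    imagePos a (n + k) = imagePos a n + imagePos a k ∧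
      ∀ i < imagePos a k, a (imagePos a n + i) = a i := by
  induction k with
  | zero => simp [imagePos_zero]
  | succ k ih =>
    obtain ⟨h1, h2⟩ := ih fun i hi => h i (by omega)
    have hk := h k (by omega)
    refine ⟨by rw [← add_assoc, imagePos_succ, imagePos_succ, h1, hk, add_assoc], fun i hi => ?_⟩
    by_cases hik : i < imagePos a k
    · exact h2 i hik
    obtain ⟨j, rfl⟩ := Nat.exists_eq_add_of_le (not_lt.1 hik)
    rw [imagePos_succ] at hi
    have hj : j < (sigma₂ (a k)).length := by omega
    rw [apply_imagePos_add ha k hj, ← add_assoc, ← h1, apply_imagePos_add ha (n + k) (by rwa [hk])]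
    simp only [hk]

/-- The shift of `a` by `n` is larger than `a` in the alternate lexicographic order, in which a
larger digit at an even position makes a word smaller, and at an odd position larger. -/
def AltLT (a : ℕ → Letter) (n : ℕ) : Prop :=
  ∃ k, (∀ i < k, a (n + i) = a i) ∧
    ((k % 2 = 0 ∧ (a (n + k)).digit < (a k).digit) ∨ (k % 2 = 1 ∧ (a k).digit < (a (n + k)).digit))

/-- The fixed point is strictly minimal among its shifts. Only shifts starting with `3` matter:
those starting with `32` are larger than `a = 31⋯`, and the others are images under `σ₂` of
earlier shifts, where `σ₂` respects the order because its images have odd lengths. -/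
theorem altLT_of_pos {a : ℕ → Letter} (ha : IsFixedPointOfMorphism sigma₂ a)
    (ha0 : a 0 = .three) {n : ℕ} (hn : 0 < n) : AltLT a n := by
  induction n using Nat.strong_induction_on with
  | _ n ih =>
  by_cases hn3 : a n = .three
  · obtain ⟨m, i, hi, rfl⟩ := exists_imagePos_add_eq a n
    have hai := apply_imagePos_add ha m hi
    obtain ⟨ham, hi03⟩ := eq_three_of_sigma₂_getElem hi (hai.symm.trans hn3)
    rcases hi03 with rfl | rfl
    · have hm0 : 0 < m := by
        rcases Nat.eq_zero_or_pos m with rfl | h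
        · simp [imagePos_zero] at hn
        · exact h
      obtain ⟨k, hk, hlt⟩ := ih m (by simpa using lt_imagePos ha0 hm0) hm0
      obtain ⟨h1, h2⟩ := imagePos_agree ha hk
      refine ⟨imagePos a k, by simpa using h2, ?_⟩
      rw [add_zero, ← h1, apply_imagePos ha, apply_imagePos ha, imagePos_mod_two]
      exact hlt
    · refine ⟨1, fun j hj => ?_, Or.inr ⟨rfl, ?_⟩⟩
      · obtain rfl : j = 0 := by omega
        rw [ha0, add_zero, hn3]
      · have e1 := apply_imagePos_add ha m (i := 4) (by simp [ham, sigma₂])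
        have e2 := apply_imagePos_add ha 0 (i := 1) (by simp [ha0, sigma₂])
        simp only [ham, ha0, sigma₂, imagePos_zero, zero_add] at e1 e2
        rw [add_assoc, e1, e2]
        simp [Letter.digit]
  · refine ⟨0, by simp, Or.inl ⟨rfl, ?_⟩⟩
    rw [add_zero, ha0]
    cases h : a n <;> simp_all [Letter.digit]

/-- The prefix `u` of odd length `p` of `a` is followed by `1 2 u 2`. -/
structure IsReturnLength (a : ℕ → Letter) (p : ℕ) : Prop where
  odd : p % 2 = 1
  one : a p = .one
  two : a (p + 1) = .two
  agree : ∀ i < p, a (p + 2 + i) = a i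
  two' : a (2 * p + 2) = .two

/-- The words `σ₂ᵏ(3)` provide arbitrarily long prefixes `u` of `a` followed by `1 2 u 2`: the
recursion is `σ₂ᵏ⁺¹(3) = σ₂ᵏ(3) 1 2 σ₂ᵏ(3) 2`. -/
theorem isReturnLength_iterate {a : ℕ → Letter} (ha : IsFixedPointOfMorphism sigma₂ a)
    (ha0 : a 0 = .three) (k : ℕ) :
    IsReturnLength a ((fun p => 2 * p + 3)^[k] 1) := by
  suffices h : IsReturnLength a ((fun p => 2 * p + 3)^[k] 1) ∧
      imagePos a ((fun p => 2 * p + 3)^[k] 1) = 2 * ((fun p => 2 * p + 3)^[k] 1) + 3 from h.1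
  induction k with
  | zero =>
    have e : ∀ i (hi : i < 5), a i = ([.three, .one, .two, .three, .two] : List Letter)[i] := by
      intro i hi
      have := apply_imagePos_add ha 0 (i := i) (by simpa [ha0, sigma₂] using hi)
      simpa [ha0, sigma₂, imagePos_zero] using this
    refine ⟨⟨rfl, by simp [e], by simp [e], fun i hi => ?_, by simp [e]⟩, ?_⟩
    · obtain rfl : i = 0 := by simpa using hi
      simp [e]
    · simp [imagePos_succ, imagePos_zero, ha0, sigma₂]
  | succ k ih =>
    rw [Function.iterate_succ_apply']
    generalize (fun p => 2 * p + 3)^[k] 1 = p at ih ⊢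
    obtain ⟨hp, hφ⟩ := ih
    have s1 : imagePos a (p + 1) = imagePos a p + 1 := by
      rw [imagePos_succ, hp.one]; rfl
    have s2 : imagePos a (p + 2) = imagePos a p + 2 := by
      rw [imagePos_succ, s1, hp.two]; rfl
    obtain ⟨s3, s4⟩ := imagePos_agree ha hp.agree
    have e : p + 2 + p = 2 * p + 2 := by ring
    rw [e, s2] at s3
    rw [s2] at s4
    have s5 : imagePos a (2 * p + 3) = imagePos a (2 * p + 2) + 1 := by
      rw [imagePos_succ, hp.two']; rfl
    have b1 := apply_imagePos ha p
    have b2 := apply_imagePos ha (p + 1)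
    have b3 := apply_imagePos ha (2 * p + 2)
    simp only [← hφ]
    refine ⟨⟨by rw [hφ]; omega, by rw [b1, hp.one], by rw [← s1, b2, hp.two], s4, ?_⟩, ?_⟩
    · rw [show 2 * imagePos a p + 2 = imagePos a (2 * p + 2) by omega, b3, hp.two']
    · nth_rewrite 1 [hφ]
      omega

/-! ### The values of the shifts and the choice of `β` -/

/-- The value `∑_{k ≥ 1} a_{n+k} / (-β)^k` of the shift by `n` of the word `a`. -/
noncomputable def tailValue (a : ℕ → Letter) (β : ℝ) (n : ℕ) : ℝ :=
  ∑' k : ℕ, ((a (n + k)).digit : ℝ) / (-β) ^ (k + 1)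

theorem Letter.one_le_digit (c : Letter) : (1 : ℝ) ≤ c.digit := by
  cases c <;> norm_num [Letter.digit]

theorem Letter.digit_le_three (c : Letter) : (c.digit : ℝ) ≤ 3 := by
  cases c <;> norm_num [Letter.digit]

theorem hasSum_div_pow_succ {β : ℝ} (hβ : 1 < β) (C : ℝ) :
    HasSum (fun k : ℕ => C / β ^ (k + 1)) (C / (β - 1)) := by
  have h := (hasSum_geometric_of_lt_one (r := β⁻¹) (by positivity)
    (inv_lt_one_of_one_lt₀ hβ)).mul_left (C / β)
  have h0 : β ≠ 0 := by positivity
  have h1 : β - 1 ≠ 0 := by linarith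
  have e1 : C / β * (1 - β⁻¹)⁻¹ = C / (β - 1) := by field_simp
  have e2 : (fun k : ℕ => C / β ^ (k + 1)) = fun k => C / β * β⁻¹ ^ k := by
    funext k
    rw [inv_pow, pow_succ]
    field_simp
  rw [e2, ← e1]
  exact h

theorem norm_tailValue_term_le (a : ℕ → Letter) {β : ℝ} (hβ : 1 < β) (n k : ℕ) :
    ‖((a (n + k)).digit : ℝ) / (-β) ^ (k + 1)‖ ≤ 3 / β ^ (k + 1) := by
  have h1 := (a (n + k)).one_le_digit
  have h2 := (a (n + k)).digit_le_three
  rw [norm_div, norm_pow, norm_neg, Real.norm_of_nonneg (by linarith : (0 : ℝ) ≤ β),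
    Real.norm_of_nonneg (by linarith)]
  gcongr

theorem summable_tailValue (a : ℕ → Letter) {β : ℝ} (hβ : 1 < β) (n : ℕ) :
    Summable fun k : ℕ => ((a (n + k)).digit : ℝ) / (-β) ^ (k + 1) :=
  .of_norm_bounded (hasSum_div_pow_succ hβ 3).summable (norm_tailValue_term_le a hβ n)

theorem abs_tailValue_le (a : ℕ → Letter) {β : ℝ} (hβ : 1 < β) (n : ℕ) :
    |tailValue a β n| ≤ 3 / (β - 1) := by
  rw [← Real.norm_eq_abs]
  exact tsum_of_norm_bounded (hasSum_div_pow_succ hβ 3) (norm_tailValue_term_le a hβ n)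

theorem abs_tailValue_sub_le (a : ℕ → Letter) {β : ℝ} (hβ : 1 < β) (m n : ℕ) :
    |tailValue a β m - tailValue a β n| ≤ 2 / (β - 1) := by
  rw [← Real.norm_eq_abs, tailValue, tailValue,
    ← (summable_tailValue a hβ m).tsum_sub (summable_tailValue a hβ n)]
  refine tsum_of_norm_bounded (hasSum_div_pow_succ hβ 2) fun k => ?_
  have h1 := (a (m + k)).one_le_digit
  have h2 := (a (m + k)).digit_le_three
  have h3 := (a (n + k)).one_le_digit
  have h4 := (a (n + k)).digit_le_three
  rw [← sub_div, norm_div, norm_pow, norm_neg, Real.norm_of_nonneg (by linarith : (0 : ℝ) ≤ β)]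
  gcongr
  rw [Real.norm_eq_abs, abs_le]
  constructor <;> linarith

theorem tailValue_succ (a : ℕ → Letter) {β : ℝ} (hβ : 1 < β) (n : ℕ) :
    tailValue a β (n + 1) = -β * tailValue a β n - (a n).digit := by
  have h0 : -β ≠ 0 := by linarith
  have e : ∀ k : ℕ, ((a (n + (k + 1))).digit : ℝ) / (-β) ^ (k + 1 + 1) =
      ((a (n + 1 + k)).digit : ℝ) / (-β) ^ (k + 1) * (-β)⁻¹ := by
    intro k
    rw [show n + (k + 1) = n + 1 + k by ring, pow_succ (-β) (k + 1), div_mul_eq_div_div,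
      div_eq_mul_inv _ (-β)]
  have h : tailValue a β n = (a n).digit / (-β) + tailValue a β (n + 1) * (-β)⁻¹ := by
    rw [tailValue, (summable_tailValue a hβ n).tsum_eq_zero_add, tailValue, ← tsum_mul_right]
    simp [e]
  rw [h]
  field_simp
  ring

theorem continuousOn_tailValue (a : ℕ → Letter) (n : ℕ) :
    ContinuousOn (fun β => tailValue a β n) (Set.Icc 3 4) := by
  refine continuousOn_tsum (u := fun k : ℕ => (3 : ℝ) / 3 ^ (k + 1)) (fun k => ?_)
    (hasSum_div_pow_succ (by norm_num) 3).summable fun k β hβ => ?_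
  · refine continuousOn_const.div (by fun_prop) fun β hβ => ?_
    have : -β ≠ 0 := by linarith [hβ.1]
    positivity
  · refine (norm_tailValue_term_le a (by linarith [hβ.1]) n k).trans ?_
    have := hβ.1
    gcongr

/-- The equation `tailValue a β 0 = -β / (β + 1)` has a solution `β`, by the intermediate value
theorem: the first digits `3 1 2 3` of `a` determine the signs at `β = 3` and `β = 4`. -/
theorem exists_tailValue_zero_eq {a : ℕ → Letter} (h0 : a 0 = .three) (h1 : a 1 = .one)
    (h2 : a 2 = .two) (h3 : a 3 = .three) :
    ∃ β : ℝ, 3 < β ∧ β < 4 ∧ tailValue a β 0 = -β / (β + 1) := by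
  have hc : ContinuousOn (fun β => tailValue a β 0 + β / (β + 1)) (Set.Icc 3 4) := by
    refine (continuousOn_tailValue a 0).add (continuousOn_id.div (by fun_prop) fun β hβ => ?_)
    linarith [hβ.1]
  have bound : ∀ β : ℝ, 3 ≤ β →
      |tailValue a β 4| ≤ 3 / (β - 1) ∧
      tailValue a β 1 = -β * tailValue a β 0 - 3 ∧ tailValue a β 2 = -β * tailValue a β 1 - 1 ∧
      tailValue a β 3 = -β * tailValue a β 2 - 2 ∧ tailValue a β 4 = -β * tailValue a β 3 - 3 := by
    intro β hβ
    have hβ1 : 1 < β := by linarith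
    refine ⟨abs_tailValue_le a hβ1 4, ?_, ?_, ?_, ?_⟩
    · simpa [h0, Letter.digit] using tailValue_succ a hβ1 0
    · simpa [h1, Letter.digit] using tailValue_succ a hβ1 1
    · simpa [h2, Letter.digit] using tailValue_succ a hβ1 2
    · simpa [h3, Letter.digit] using tailValue_succ a hβ1 3
  have hlo : tailValue a 3 0 + 3 / (3 + 1) < 0 := by
    obtain ⟨b, e0, e1, e2, e3⟩ := bound 3 le_rfl
    have := abs_le.1 b
    norm_num at this
    linarith
  have hhi : 0 < tailValue a 4 0 + 4 / (4 + 1) := by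
    obtain ⟨b, e0, e1, e2, e3⟩ := bound 4 (by norm_num)
    have := abs_le.1 b
    norm_num at this
    linarith
  obtain ⟨β, ⟨hβ3, hβ4⟩, hβ⟩ := intermediate_value_Ioo (by norm_num : (3 : ℝ) ≤ 4) hc ⟨hlo, hhi⟩
  refine ⟨β, hβ3, hβ4, ?_⟩
  rw [neg_div]
  simp only at hβ
  linarith

/-- For `β > 3`, the alternate lexicographic order of the shifts is the order of their values. -/
theorem tailValue_zero_lt_of_altLT {a : ℕ → Letter} {β : ℝ} (hβ : 3 < β) {n : ℕ}
    (h : AltLT a n) : tailValue a β 0 < tailValue a β n := by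
  have hβ1 : 1 < β := by linarith
  -- Two shifts have values at distance less than `1`, so the first digits decide.
  have key : ∀ i j, (a i).digit < (a j).digit → tailValue a β j < tailValue a β i := by
    intro i j hij
    have e1 := tailValue_succ a hβ1 i
    have e2 := tailValue_succ a hβ1 j
    have hd : ((a i).digit : ℝ) + 1 ≤ (a j).digit := by exact_mod_cast hij
    have hlt : 2 / (β - 1) < 1 := by rw [div_lt_one (by linarith)]; linarith
    have hs := (abs_le.1 (abs_tailValue_sub_le a hβ1 (i + 1) (j + 1))).2
    have : 0 < β * (tailValue a β i - tailValue a β j) := by linarith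
    have := pos_of_mul_pos_right this (by linarith)
    linarith
  obtain ⟨k, hk, hlt⟩ := h
  have e : tailValue a β (n + k) - tailValue a β k =
      (-β) ^ k * (tailValue a β n - tailValue a β 0) := by
    clear hlt
    induction k with
    | zero => simp
    | succ k ih =>
      rw [← add_assoc, tailValue_succ a hβ1, tailValue_succ a hβ1, hk k (by omega), pow_succ]
      linear_combination (-β) * ih fun i hi => hk i (by omega)
  rcases hlt with ⟨hp, hd⟩ | ⟨hp, hd⟩
  · have := key _ _ hd
    rw [(Nat.even_iff.2 hp).neg_pow] at e
    have : 0 < β ^ k * (tailValue a β n - tailValue a β 0) := by linarith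
    have := pos_of_mul_pos_right this (by positivity)
    linarith
  · have := key _ _ hd
    rw [(Nat.odd_iff.2 hp).neg_pow] at e
    have : 0 < β ^ k * (tailValue a β n - tailValue a β 0) := by linarith
    have := pos_of_mul_pos_right this (by positivity)
    linarith

/-- `t` is the orbit of `-β / (β + 1)` under the `(-β)`-transformation, with the digits `a`, for
some `β` between `3` and `4`; the orbit stays in the negative part of the interval. -/
structure IsCriticalOrbit (a : ℕ → Letter) (β : ℝ) (t : ℕ → ℝ) : Prop where
  three_lt : 3 < β
  lt_four : β < 4
  zero : t 0 = -β / (β + 1)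
  succ : ∀ n, t (n + 1) = -β * t n - (a n).digit
  le : ∀ n, t 0 ≤ t n
  neg : ∀ n, t n < 0

theorem exists_isCriticalOrbit {a : ℕ → Letter} (ha : IsFixedPointOfMorphism sigma₂ a)
    (ha0 : a 0 = .three) : ∃ β : ℝ, IsCriticalOrbit a β (tailValue a β) := by
  have hr := isReturnLength_iterate ha ha0 0
  have h3 := hr.agree 0 Nat.one_pos
  rw [ha0] at h3
  obtain ⟨β, hβ3, hβ4, hβ⟩ := exists_tailValue_zero_eq ha0 hr.one hr.two h3
  have hβ1 : 1 < β := by linarith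
  have hle : ∀ n, tailValue a β 0 ≤ tailValue a β n := fun n => by
    rcases Nat.eq_zero_or_pos n with rfl | hn
    · exact le_rfl
    · exact (tailValue_zero_lt_of_altLT hβ3 (altLT_of_pos ha ha0 hn)).le
  refine ⟨β, hβ3, hβ4, hβ, fun n => tailValue_succ a hβ1 n, hle, fun n => ?_⟩
  have h1 := tailValue_succ a hβ1 n
  have h2 := (a n).one_le_digit
  have h4 := hle (n + 1)
  have h5 : -1 < tailValue a β 0 := by
    rw [hβ, neg_div, neg_lt_neg_iff, div_lt_one] <;> linarith
  by_contra! h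
  nlinarith

/-! ### The orbit under the `(-β)`-transformation -/

theorem floor_eq_and_negBetaMap_eq {β x : ℝ} {d : ℤ} (hβ : 1 < β)
    (h : -β * x - d ∈ Set.Ico (-β / (β + 1)) (1 / (β + 1))) :
    ⌊β / (β + 1) - β * x⌋ = d ∧ negBetaMap β x = -β * x - d := by
  have h3 : 1 / (β + 1) = 1 - β / (β + 1) := by field_simp; ring
  rw [Set.mem_Ico, h3, neg_div] at h
  have hf : ⌊β / (β + 1) - β * x⌋ = d := by
    rw [Int.floor_eq_iff]
    constructor <;> linarith
  exact ⟨hf, by rw [negBetaMap, hf]⟩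

namespace IsCriticalOrbit

variable {a : ℕ → Letter} {β : ℝ} {t : ℕ → ℝ}

theorem Ico_eq (ht : IsCriticalOrbit a β t) :
    Set.Ico (-β / (β + 1)) (1 / (β + 1)) = Set.Ico (t 0) (t 0 + 1) := by
  have := ht.three_lt
  rw [ht.zero]
  congr 1
  field_simp
  ring

theorem negBetaMap_eq (ht : IsCriticalOrbit a β t) {x y : ℝ} (d : ℤ) (hy : y = -β * x - d)
    (h0 : t 0 ≤ y) (h1 : y < t 0 + 1) : negBetaMap β x = y := by
  subst hy
  refine (floor_eq_and_negBetaMap_eq (by linarith [ht.three_lt]) ?_).2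
  rw [ht.Ico_eq]
  exact ⟨h0, h1⟩

theorem zero_lt (ht : IsCriticalOrbit a β t) : t 0 < -3 / 4 := by
  have := ht.three_lt
  rw [ht.zero, div_lt_div_iff₀] <;> linarith

theorem lt_zero (ht : IsCriticalOrbit a β t) : -4 / 5 < t 0 := by
  have := ht.three_lt
  have := ht.lt_four
  rw [ht.zero, div_lt_div_iff₀] <;> linarith

theorem iterate_zero (ht : IsCriticalOrbit a β t) (n : ℕ) :
    (negBetaMap β)^[n] (t 0) = t n := by
  induction n with
  | zero => rfl
  | succ n ih =>
    rw [Function.iterate_succ_apply', ih]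
    exact ht.negBetaMap_eq (a n).digit (ht.succ n) (ht.le _)
      (by linarith [ht.neg (n + 1), ht.lt_zero])

theorem isNegBetaExpansion {a : ℕ → Letter} {β : ℝ} (ht : IsCriticalOrbit a β (tailValue a β)) :
    IsNegBetaExpansion β (-β / (β + 1)) fun n => (a n).digit := by
  have hβ : 1 < β := by linarith [ht.three_lt]
  have hT := ht.iterate_zero
  rw [ht.zero] at hT
  refine ⟨?_, fun n => ?_, fun n => ?_⟩
  · rw [ht.Ico_eq, ← ht.zero]
    exact ⟨le_rfl, by linarith⟩
  · refine (floor_eq_and_negBetaMap_eq hβ ?_).1.symm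
    rw [hT, ← ht.succ, ht.Ico_eq]
    exact ⟨ht.le _, by linarith [ht.neg (n + 1), ht.lt_zero]⟩
  · rw [hT]
    exact (summable_tailValue a hβ n).hasSum

/-! ### Long intervals on which an iterate is negative -/

theorem sub_eq (ht : IsCriticalOrbit a β t) {n p : ℕ} (h : ∀ i < p, a (n + i) = a i) :
    t (n + p) - t p = (-β) ^ p * (t n - t 0) := by
  induction p with
  | zero => simp
  | succ p ih =>
    rw [← add_assoc, ht.succ, ht.succ, h p (by omega), pow_succ]
    linear_combination (-β) * ih fun i hi => h i (by omega)

/-- If `t 0` and `t n` have the same first `p` digits, then so have all points between them, and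
the `p`-th iterate of the transformation is affine there. -/
theorem iterate_convexCombination (ht : IsCriticalOrbit a β t) {n p : ℕ}
    (h : ∀ i < p, a (n + i) = a i) {s : ℝ} (hs0 : 0 ≤ s) (hs1 : s ≤ 1) :
    (negBetaMap β)^[p] (t 0 + s * (t n - t 0)) = t p + s * (t (n + p) - t p) := by
  induction p with
  | zero => simp
  | succ p ih =>
    rw [Function.iterate_succ_apply', ih fun i hi => h i (by omega)]
    have h1 := ht.le (p + 1)
    have h2 := ht.le (n + (p + 1))
    have h3 := ht.neg (p + 1)
    have h4 := ht.neg (n + (p + 1))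
    have h5 := ht.lt_zero
    refine ht.negBetaMap_eq (a p).digit ?_ ?_ ?_
    · rw [← add_assoc, ht.succ, ht.succ, h p (by omega)]
      ring
    · nlinarith
    · nlinarith

end IsCriticalOrbit

/-- The `q`-th iterate of the `(-β)`-transformation, at the scale `β ^ (-q)` to the right of `t 0`,
is a translation on an interval of (scaled) length `1 / 4`, and is negative on an interval of
(scaled) length `L`. -/
structure IsNegativeAt (β : ℝ) (t : ℕ → ℝ) (q : ℕ) (L : ℝ) : Prop where
  translation : ∀ y, 0 ≤ y → y ≤ 1 / 4 → (negBetaMap β)^[q] (t 0 + y / β ^ q) = t q + y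
  neg : ∀ y, 0 ≤ y → y ≤ L → (negBetaMap β)^[q] (t 0 + y / β ^ q) < 0

namespace IsCriticalOrbit

variable {a : ℕ → Letter} {β : ℝ} {t : ℕ → ℝ}

theorem quarter_le_sub (ht : IsCriticalOrbit a β t) {i j : ℕ} (h1 : a i = .one)
    (h2 : a (i + 1) = .two) (h3 : a j = .two) (h4 : a (j + 1) = .one) : 1 / 4 ≤ t i - t j := by
  have e1 := ht.succ i
  have e2 := ht.succ (i + 1)
  have e3 := ht.succ j
  have e4 := ht.succ (j + 1)
  simp only [h1, h2, h3, h4, Letter.digit, Int.cast_one, Int.cast_ofNat] at e1 e2 e3 e4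
  have b1 := ht.le (i + 1 + 1)
  have b2 := ht.neg (j + 1 + 1)
  have b3 := ht.lt_zero
  have hβ := ht.three_lt
  have hβ' := ht.lt_four
  have h5 : 0 < β * (t (j + 1) - t (i + 1)) := by linarith
  have h6 := pos_of_mul_pos_right h5 (by linarith)
  by_contra! h
  nlinarith

/-- The recursion behind the unbounded gaps. Write `T` for the `(-β)`-transformation. For `y ≥ 0`
in the given range, `T ^ (q + 3)` maps `t 0 + y / β ^ (2 * q + 4)` to `t (q + 3) - z` with
`z = y / β ^ (q + 1)`, as long as this is at least `t 0`; the points `t (q + 3)` and `t 0` share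
`q + 1` digits, so `T ^ (2 * q + 4)` is a translation there, with negative values, and covers a
length `t (q + 1) - t (2 * q + 4) ≥ 1 / 4`. Beyond this range, the point reappears just below the
right end of the interval, and `T ^ (q + 4)` maps it to the right of `t 0`, where the hypothesis on
`T ^ q` applies. -/
theorem isNegativeAt_step (ht : IsCriticalOrbit a β t) {q k : ℕ}
    (hq : IsReturnLength a (q + 1)) (hq' : a (2 * q + 5) = .one) (hkq : k ≤ q)
    (h : IsNegativeAt β t q (k / 4)) :
    IsNegativeAt β t (2 * q + 4) (((k + 1 : ℕ) : ℝ) / 4) := by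
  have hβ := ht.three_lt
  have hβ' := ht.lt_four
  have hβ0 : (0 : ℝ) < β := by linarith
  have hl := ht.lt_zero
  have hr := ht.zero_lt
  have hqe : Even q := by
    have := hq.odd
    exact Nat.even_iff.2 (by omega)
  have hkq' : (k : ℝ) ≤ q := by exact_mod_cast hkq
  have htwo : a (2 * q + 4) = .two := hq.two'
  have hc : 1 / 4 ≤ t (q + 1) - t (2 * q + 4) := ht.quarter_le_sub hq.one hq.two htwo hq'
  have hpow : 3 * ((q : ℝ) + 1) ≤ β ^ (q + 1) := by
    have h1 : 3 * ((q : ℝ) + 1) ≤ 3 ^ (q + 1) := by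
      have : q + 1 ≤ 3 ^ q := Nat.lt_pow_self (by norm_num)
      rw [pow_succ]
      have : (q : ℝ) + 1 ≤ 3 ^ q := by exact_mod_cast this
      linarith
    exact h1.trans (by gcongr)
  have hpow0 : 0 < β ^ (q + 1) := by positivity
  have hagree : ∀ i < q + 1, a (q + 3 + i) = a i := hq.agree
  have hD : β ^ (q + 1) * (t (q + 3) - t 0) = t (q + 1) - t (2 * q + 4) := by
    have e := ht.sub_eq hagree
    rw [(hqe.add_one).neg_pow, show q + 3 + (q + 1) = 2 * q + 4 by ring] at e
    linear_combination e
  have hD0 : 0 < t (q + 3) - t 0 := pos_of_mul_pos_right (by rw [hD]; linarith) hpow0.le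
  have e0 := ht.succ q
  have e1 := ht.succ (q + 1)
  have e2 := ht.succ (q + 2)
  simp only [hq.one, show a (q + 2) = .two from hq.two, Letter.digit, Int.cast_one,
    Int.cast_ofNat] at e1 e2
  -- The two ranges of `y` correspond to `z ≤ t (q + 3) - t 0` and `t (q + 3) - t 0 < z`.
  have main : ∀ y, 0 ≤ y → y ≤ ((k + 1 : ℕ) : ℝ) / 4 →
      (y ≤ t (q + 1) - t (2 * q + 4) →
        (negBetaMap β)^[2 * q + 4] (t 0 + y / β ^ (2 * q + 4)) = t (2 * q + 4) + y ∧
        t (2 * q + 4) + y < 0) ∧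
      (t (q + 1) - t (2 * q + 4) < y →
        (negBetaMap β)^[2 * q + 4] (t 0 + y / β ^ (2 * q + 4)) < 0) := by
    intro y hy0 hy
    push_cast at hy
    -- `w` is the displacement from `t q` after `q` steps; three more steps turn it into `-z`.
    obtain ⟨w, hw⟩ : ∃ w, w = y / β ^ (q + 4) := ⟨_, rfl⟩
    obtain ⟨z, hz⟩ : ∃ z, z = y / β ^ (q + 1) := ⟨_, rfl⟩
    have hyz : y = β ^ (q + 1) * z := by rw [hz]; field_simp
    have hzw : z = β ^ 3 * w := by rw [hz, hw]; field_simp; ring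
    have hz0 : 0 ≤ z := by rw [hz]; positivity
    have hw0 : 0 ≤ w := by rw [hw]; positivity
    -- This bound keeps the perturbed orbit in the branches of the orbit of `t 0` for three steps.
    have hz1 : z ≤ 1 / 12 := by
      rw [hz, div_le_iff₀ hpow0]
      linarith
    have hbw : β * w ≤ β ^ 3 * w := by
      have : β ≤ β ^ 3 := le_self_pow₀ (by linarith) (by norm_num)
      gcongr
    have hbbw : β ^ 2 * w ≤ β ^ 3 * w := by
      gcongr <;> linarith
    have hww : w ≤ β * w := le_mul_of_one_le_left hw0 (by linarith)
    have s0 : (negBetaMap β)^[q] (t 0 + y / β ^ (2 * q + 4)) = t q + w := by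
      have : y / β ^ (2 * q + 4) = w / β ^ q := by
        rw [hw, div_div, ← pow_add]
        ring_nf
      rw [this, h.translation w hw0 (by linarith)]
    have b1 : -(2 / 5) < t (q + 1) := by
      have := ht.neg (q + 2)
      by_contra! hcon
      linarith [mul_le_mul_of_nonneg_left hcon hβ0.le]
    have b2 : t (q + 2) < -(1 / 4) := by
      have := ht.le (q + 3)
      by_contra! hcon
      linarith [mul_le_mul_of_nonneg_left hcon hβ0.le]
    have s1 : (negBetaMap β)^[q + 1] (t 0 + y / β ^ (2 * q + 4)) = t (q + 1) - β * w := by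
      rw [Function.iterate_succ_apply', s0]
      refine ht.negBetaMap_eq (a q).digit (by rw [e0]; ring) (by linarith) ?_
      linarith [ht.neg (q + 1), mul_nonneg hβ0.le hw0]
    have s2 : (negBetaMap β)^[q + 2] (t 0 + y / β ^ (2 * q + 4)) = t (q + 2) + β ^ 2 * w := by
      rw [Function.iterate_succ_apply', s1]
      refine ht.negBetaMap_eq 1 (by rw [e1]; push_cast; ring) ?_ (by linarith)
      linarith [ht.le (q + 2), mul_nonneg (sq_nonneg β) hw0]
    refine ⟨fun hc1 => ?_, fun hc2 => ?_⟩
    · have hzD : z ≤ t (q + 3) - t 0 := by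
        rw [← hD, hyz] at hc1
        exact le_of_mul_le_mul_left hc1 hpow0
      have s3 : (negBetaMap β)^[q + 3] (t 0 + y / β ^ (2 * q + 4)) = t (q + 3) - z := by
        rw [Function.iterate_succ_apply', s2]
        refine ht.negBetaMap_eq 2 (by rw [e2, hzw]; push_cast; ring) (by linarith) ?_
        linarith [ht.neg (q + 3)]
      have s4 := ht.iterate_convexCombination hagree (s := 1 - z / (t (q + 3) - t 0))
        (by rw [sub_nonneg, div_le_one hD0]; exact hzD) (by linarith [div_nonneg hz0 hD0.le])
      have e4 : t 0 + (1 - z / (t (q + 3) - t 0)) * (t (q + 3) - t 0) = t (q + 3) - z := by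
        field_simp
        ring
      have e5 : t (q + 1) + (1 - z / (t (q + 3) - t 0)) * (t (2 * q + 4) - t (q + 1)) =
          t (2 * q + 4) + y := by
        have : t (2 * q + 4) - t (q + 1) = -(β ^ (q + 1) * (t (q + 3) - t 0)) := by
          rw [hD]; ring
        have e6 : y = z / (t (q + 3) - t 0) * (β ^ (q + 1) * (t (q + 3) - t 0)) := by
          rw [hyz]; field_simp
        linear_combination -(z / (t (q + 3) - t 0)) * this - e6
      rw [e4, show q + 3 + (q + 1) = 2 * q + 4 by ring, e5, ← s3, ← Function.iterate_add_apply,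
        show q + 1 + (q + 3) = 2 * q + 4 by ring] at s4
      exact ⟨s4, by linarith [ht.neg (q + 1)]⟩
    · -- Here `t (q + 3) - z` has left the domain on the left, and the digit drops from `2` to `1`.
      have hzD : t (q + 3) - t 0 < z := by
        rw [← hD, hyz] at hc2
        exact lt_of_mul_lt_mul_left hc2 hpow0.le
      have s3 : (negBetaMap β)^[q + 3] (t 0 + y / β ^ (2 * q + 4)) = t (q + 3) - z + 1 := by
        rw [Function.iterate_succ_apply', s2]
        refine ht.negBetaMap_eq 1 (by rw [e2, hzw]; push_cast; ring) ?_ (by linarith)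
        linarith [ht.le (q + 3)]
      have s4 : (negBetaMap β)^[q + 4] (t 0 + y / β ^ (2 * q + 4)) =
          t 0 + (y - (t (q + 1) - t (2 * q + 4))) / β ^ q := by
        have e4 : (y - (t (q + 1) - t (2 * q + 4))) / β ^ q = β * (z - (t (q + 3) - t 0)) := by
          rw [← hD, hyz, pow_succ]
          field_simp
        rw [Function.iterate_succ_apply', s3, e4]
        have e5 : t 0 * (β + 1) = -β := by
          rw [ht.zero]
          field_simp
        have hδ0 : 0 ≤ β * (z - (t (q + 3) - t 0)) := mul_nonneg hβ0.le (by linarith)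
        have hδ1 : β * (z - (t (q + 3) - t 0)) ≤ 4 * (1 / 12) := by
          gcongr
          linarith
        refine ht.negBetaMap_eq 0 ?_ (by linarith) (by linarith)
        push_cast
        linear_combination e5
      have s5 := h.neg (y - (t (q + 1) - t (2 * q + 4))) (by linarith) (by linarith)
      rwa [← s4, ← Function.iterate_add_apply, show q + (q + 4) = 2 * q + 4 by ring] at s5
  refine ⟨fun y hy0 hy => ?_, fun y hy0 hy => ?_⟩
  · have hk : (0 : ℝ) ≤ k := k.cast_nonneg
    exact ((main y hy0 (by push_cast; linarith)).1 (by linarith)).1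
  · obtain ⟨m1, m2⟩ := main y hy0 hy
    rcases le_or_gt y (t (q + 1) - t (2 * q + 4)) with hc1 | hc2
    · rw [(m1 hc1).1]
      exact (m1 hc1).2
    · exact m2 hc2

theorem exists_isNegativeAt (ht : IsCriticalOrbit a β t) (ha : IsFixedPointOfMorphism sigma₂ a)
    (ha0 : a 0 = .three) (k : ℕ) :
    ∃ q, Even q ∧ k ≤ q ∧ IsNegativeAt β t q (k / 4) := by
  suffices h : ∃ q, q + 1 = (fun p => 2 * p + 3)^[k] 1 ∧ k ≤ q ∧ IsNegativeAt β t q (k / 4) by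
    obtain ⟨q, h1, h2, h3⟩ := h
    have := (isReturnLength_iterate ha ha0 k).odd
    exact ⟨q, Nat.even_iff.2 (by omega), h2, h3⟩
  induction k with
  | zero =>
    refine ⟨0, rfl, le_rfl, fun y _ _ => by simp, fun y hy0 hy => ?_⟩
    obtain rfl : y = 0 := by
      norm_num at hy
      linarith
    simpa using ht.neg 0
  | succ k ih =>
    obtain ⟨q, h1, h2, h3⟩ := ih
    have r1 := isReturnLength_iterate ha ha0 k
    have r2 := isReturnLength_iterate ha ha0 (k + 1)
    rw [Function.iterate_succ_apply', ← h1] at r2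
    rw [← h1] at r1
    refine ⟨2 * q + 4, ?_, by omega, ht.isNegativeAt_step r1 r2.one h2 h3⟩
    rw [Function.iterate_succ_apply', ← h1]
    ring

/-! ### The set of `(-β)`-integers -/

theorem iterate_div_pow (ht : IsCriticalOrbit a β t) {v : ℝ} (hv : v ∈ Set.Ioo (t 0) (t 0 + 1))
    (j : ℕ) : v / (-β) ^ j ∈ Set.Ioo (t 0) (t 0 + 1) ∧
      (negBetaMap β)^[j] (v / (-β) ^ j) = v := by
  have hβ := ht.three_lt
  have hβ' := ht.lt_four
  have e5 : t 0 * (β + 1) = -β := by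
    rw [ht.zero]
    field_simp
  have hl := ht.lt_zero
  have hr := ht.zero_lt
  induction j with
  | zero => simpa using hv
  | succ j ih =>
    obtain ⟨⟨h1, h2⟩, h3⟩ := ih
    obtain ⟨u, hu⟩ : ∃ u, u = v / (-β) ^ (j + 1) := ⟨_, rfl⟩
    have e : v / (-β) ^ j = -β * u := by
      have : -β ≠ 0 := by linarith
      rw [hu, pow_succ]
      field_simp
    rw [e] at h1 h2 h3
    rw [← hu]
    refine ⟨⟨?_, ?_⟩, ?_⟩
    · nlinarith
    · nlinarith
    · rw [Function.iterate_succ_apply, ht.negBetaMap_eq 0 (by push_cast; ring) h1.le h2, h3]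

/-- Membership in the set of `(-β)`-integers can be tested after any scaling that brings the point
into the interior of the domain of the transformation. -/
theorem iterate_eq_zero (ht : IsCriticalOrbit a β t) {x : ℝ} (hx : x ∈ negBetaIntegers β) {n : ℕ}
    (hn : x / (-β) ^ n ∈ Set.Ioo (t 0) (t 0 + 1)) :
    (negBetaMap β)^[n] (x / (-β) ^ n) = 0 := by
  have h0 : -β ≠ 0 := by linarith [ht.three_lt]
  simp only [negBetaIntegers, Set.mem_iUnion, Set.mem_image, Set.mem_ofPred_eq, ht.Ico_eq] at hx
  obtain ⟨N, y, ⟨⟨hy0, hy1⟩, hyN⟩, rfl⟩ := hx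
  rcases le_total n N with h | h
  · obtain ⟨j, rfl⟩ := Nat.exists_eq_add_of_le h
    have e : y = (-β) ^ (n + j) * y / (-β) ^ n / (-β) ^ j := by
      rw [div_div, ← pow_add]
      field_simp
    rw [← (ht.iterate_div_pow hn j).2, ← e, ← Function.iterate_add_apply, hyN]
  · obtain ⟨j, rfl⟩ := Nat.exists_eq_add_of_le h
    have e : (-β) ^ N * y / (-β) ^ (N + j) = y / (-β) ^ j := by
      rw [pow_add]
      field_simp
    -- The left endpoint `t 0` is excluded because its orbit never meets `0`.
    have hy : t 0 < y := hy0.lt_of_ne fun hcon => by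
      rw [← hcon, ht.iterate_zero] at hyN
      exact (ht.neg N).ne hyN
    rw [e, Function.iterate_add_apply, (ht.iterate_div_pow ⟨hy, hy1⟩ j).2, hyN]

theorem finite_preimage_zero (ht : IsCriticalOrbit a β t) (n : ℕ) :
    {x | x ∈ Set.Ico (t 0) (t 0 + 1) ∧ (negBetaMap β)^[n] x = 0}.Finite := by
  have hβ := ht.three_lt
  have hβ' := ht.lt_four
  induction n with
  | zero => exact (Set.finite_singleton 0).subset fun x hx => by simpa using hx.2
  | succ n ih =>
    refine ((Set.finite_Icc (-5 : ℤ) 5).image2 (fun (d : ℤ) (z : ℝ) => -(z + d) / β) ih).subset ?_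
    rintro x ⟨⟨hx0, hx1⟩, hx⟩
    rw [Function.iterate_succ_apply] at hx
    have hm := negBetaMap_mem (by linarith : 1 < β) x
    rw [ht.Ico_eq] at hm
    have h0 := ht.zero
    rw [neg_div] at h0
    have hl := ht.lt_zero
    have hr := ht.zero_lt
    refine ⟨⌊β / (β + 1) - β * x⌋, ⟨?_, ?_⟩, negBetaMap β x, ⟨hm, hx⟩, ?_⟩
    · rw [Int.le_floor]
      push_cast
      nlinarith
    · rw [← Int.lt_add_one_iff, Int.floor_lt]
      push_cast
      nlinarith
    · simp only [negBetaMap]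
      field_simp
      ring

theorem finite_inter_Icc (ht : IsCriticalOrbit a β t) (M : ℝ) :
    (negBetaIntegers β ∩ Set.Icc (-M) M).Finite := by
  have hβ := ht.three_lt
  have hl := ht.lt_zero
  have hr := ht.zero_lt
  obtain ⟨n, hn⟩ := pow_unbounded_of_one_lt (5 * M) (by linarith : 1 < β)
  have h0 : (-β) ^ n ≠ 0 := pow_ne_zero _ (by linarith)
  refine ((ht.finite_preimage_zero n).image fun x => (-β) ^ n * x).subset ?_
  rintro x ⟨hx, hx1, hx2⟩
  have hlt : |x / (-β) ^ n| < 1 / 5 := by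
    rw [abs_div, abs_pow, abs_neg, abs_of_pos (by linarith : 0 < β), div_lt_iff₀ (by positivity)]
    have := abs_le.2 ⟨hx1, hx2⟩
    linarith
  obtain ⟨h1, h2⟩ := abs_lt.1 hlt
  have hmem : x / (-β) ^ n ∈ Set.Ioo (t 0) (t 0 + 1) := ⟨by linarith, by linarith⟩
  exact ⟨_, ⟨Set.Ioo_subset_Ico_self hmem, ht.iterate_eq_zero hx hmem⟩, by field_simp⟩

theorem pow_mem_negBetaIntegers (ht : IsCriticalOrbit a β t) (n : ℕ) :
    (-β) ^ n ∈ negBetaIntegers β := by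
  have hβ := ht.three_lt
  have hβ' := ht.lt_four
  have hl := ht.lt_zero
  have hr := ht.zero_lt
  simp only [negBetaIntegers, Set.mem_iUnion, Set.mem_image, Set.mem_ofPred_eq, ht.Ico_eq]
  have e1 : negBetaMap β (-1 / β) = 0 :=
    ht.negBetaMap_eq 1 (by push_cast; field_simp; ring) (by linarith) (by linarith)
  have e2 : ∀ n, (negBetaMap β)^[n] 0 = 0 := fun n =>
    Function.iterate_fixed (ht.negBetaMap_eq 0 (by simp) (by linarith) (by linarith)) n
  refine ⟨n + 1, -1 / β, ⟨⟨?_, ?_⟩, ?_⟩, ?_⟩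
  · have : -1 / 3 < -1 / β := by
      rw [div_lt_div_iff₀] <;> linarith
    linarith
  · have : -1 / β < 0 := div_neg_of_neg_of_pos (by norm_num) (by linarith)
    linarith
  · rw [Function.iterate_succ_apply, e1, e2]
  · rw [pow_succ]
    field_simp

theorem exists_ge_mem (ht : IsCriticalOrbit a β t) (u : ℝ) : ∃ x ∈ negBetaIntegers β, u ≤ x := by
  have hβ := ht.three_lt
  obtain ⟨n, hn⟩ := pow_unbounded_of_one_lt u (by nlinarith : 1 < β ^ 2)
  refine ⟨_, ht.pow_mem_negBetaIntegers (2 * n), ?_⟩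
  rw [pow_mul, neg_sq]
  exact hn.le

theorem exists_le_mem (ht : IsCriticalOrbit a β t) (u : ℝ) : ∃ x ∈ negBetaIntegers β, x ≤ u := by
  have hβ := ht.three_lt
  obtain ⟨n, hn⟩ := pow_unbounded_of_one_lt (-u) (by nlinarith : 1 < β ^ 2)
  refine ⟨_, ht.pow_mem_negBetaIntegers (2 * n + 1), ?_⟩
  rw [pow_succ, pow_mul, neg_sq]
  have : (0 : ℝ) < (β ^ 2) ^ n := by positivity
  nlinarith

/-- Every interval without `(-β)`-integers lies between two consecutive `(-β)`-integers. -/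
theorem exists_isConsecutive (ht : IsCriticalOrbit a β t) {u v : ℝ} (huv : u < v)
    (h : negBetaIntegers β ∩ Set.Ioo u v = ∅) :
    ∃ x y, IsConsecutive (negBetaIntegers β) x y ∧ x ≤ u ∧ v ≤ y := by
  obtain ⟨x₀, hx₀, hx₀u⟩ := ht.exists_le_mem u
  obtain ⟨y₀, hy₀, hvy₀⟩ := ht.exists_ge_mem v
  have fin : ∀ c d, (negBetaIntegers β ∩ Set.Icc c d).Finite := fun c d =>
    (ht.finite_inter_Icc (max (-c) d)).subset fun z hz =>
      ⟨hz.1, by linarith [hz.2.1, le_max_left (-c) d], hz.2.2.trans (le_max_right _ _)⟩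
  obtain ⟨x, ⟨hx, hx1, hx2⟩, hxm⟩ := Set.exists_max_image _ id (fin x₀ u) ⟨x₀, hx₀, le_rfl, hx₀u⟩
  obtain ⟨y, ⟨hy, hy1, hy2⟩, hym⟩ := Set.exists_min_image _ id (fin v y₀) ⟨y₀, hy₀, hvy₀, le_rfl⟩
  refine ⟨x, y, ⟨hx, hy, by linarith, ?_⟩, hx2, hy1⟩
  rw [Set.eq_empty_iff_forall_notMem] at h ⊢
  rintro z ⟨hz, hz1, hz2⟩
  rcases le_or_gt z u with hzu | hzu
  · exact hz1.not_ge (hxm z ⟨hz, by linarith, hzu⟩)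
  rcases le_or_gt v z with hvz | hvz
  · exact hz2.not_ge (hym z ⟨hz, hvz, by linarith⟩)
  exact h z ⟨hz, hzu, hvz⟩

theorem exists_long_gap (ht : IsCriticalOrbit a β t) (ha : IsFixedPointOfMorphism sigma₂ a)
    (ha0 : a 0 = .three) (C : ℝ) :
    ∃ x y, IsConsecutive (negBetaIntegers β) x y ∧ C < y - x := by
  have hβ := ht.three_lt
  -- The gap lies to the right of `(-β) ^ q * t 0`, where `q` is even.
  obtain ⟨k, hk⟩ := exists_nat_gt (4 * max C 0)
  have hk0 : (0 : ℝ) < k := lt_of_le_of_lt (by positivity) hk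
  obtain ⟨q, hq, hkq, hneg⟩ := ht.exists_isNegativeAt ha ha0 k
  have hpos : 0 < β ^ q := by positivity
  have hkpow : (k : ℝ) < β ^ q := by
    have h1 : (q : ℝ) < 3 ^ q := by exact_mod_cast Nat.lt_pow_self (by norm_num : 1 < 3)
    have h2 : (3 : ℝ) ^ q ≤ β ^ q := by gcongr
    have h3 : (k : ℝ) ≤ q := by exact_mod_cast hkq
    linarith
  have hgap : negBetaIntegers β ∩ Set.Ioo (β ^ q * t 0) (β ^ q * t 0 + k / 4) = ∅ := by
    rw [Set.eq_empty_iff_forall_notMem]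
    rintro x ⟨hx, hx1, hx2⟩
    have e : x / (-β) ^ q = t 0 + (x - β ^ q * t 0) / β ^ q := by
      rw [hq.neg_pow]
      field_simp
      ring
    have hy0 : 0 < (x - β ^ q * t 0) / β ^ q := div_pos (by linarith) hpos
    have hy1 : (x - β ^ q * t 0) / β ^ q < 1 := by
      rw [div_lt_one hpos]
      linarith
    have hz := ht.iterate_eq_zero hx (n := q) ⟨by linarith, by linarith⟩
    have hz' := hneg.neg (x - β ^ q * t 0) (by linarith) (by linarith)
    rw [← e, hz] at hz'
    exact lt_irrefl _ hz'
  obtain ⟨x, y, hxy, hx, hy⟩ := ht.exists_isConsecutive (by linarith) hgap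
  exact ⟨x, y, hxy, by linarith [le_max_left C 0]⟩

end IsCriticalOrbit

theorem not_isRelativelyDense_of_isConsecutive {S : Set ℝ}
    (h : ∀ C : ℝ, ∃ x y : ℝ, IsConsecutive S x y ∧ C < y - x) : ¬ IsRelativelyDense S := by
  rintro ⟨R, -, hR⟩
  obtain ⟨x, y, ⟨-, -, -, he⟩, hC⟩ := h R
  obtain ⟨z, hz, hz1, hz2⟩ := hR (x + (y - x - R) / 2)
  exact Set.eq_empty_iff_forall_notMem.1 he z ⟨hz, by linarith, by linarith⟩

theorem mainTheorem2 (a : ℕ → Letter) (ha : IsFixedPointOfMorphism sigma₂ a)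
    (ha0 : a 0 = Letter.three) :
    ∃ β : ℝ, 1 < β ∧
      IsNegBetaExpansion β (-β / (β + 1)) (fun n => (a n).digit) ∧
      ¬ IsRelativelyDense (negBetaIntegers β) ∧
      ∀ C : ℝ, ∃ x y : ℝ, IsConsecutive (negBetaIntegers β) x y ∧ C < y - x := by
  obtain ⟨β, ht⟩ := exists_isCriticalOrbit ha ha0
  have hgap := ht.exists_long_gap ha ha0
  exact ⟨β, by linarith [ht.three_lt], ht.isNegBetaExpansion,
    not_isRelativelyDense_of_isConsecutive hgap, hgap⟩
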